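/- Let $D\subset\mathbb C$ be a bounded domain, $0<\alpha<2$ and $1<p<\infty$. For a Lebesgue measurable $\mu:\mathbb C\to[0,\infty)$ put $$A_p(\mu)=\sup_B\left(\frac1{|B|}\int_B\mu\,dV\right)\left(\frac1{|B|}\int_B\mu^{\frac1{1-p}}\,dV\right)^{p-1}\in[0,\infty],$$ where the supremum is over all discs $B\subset\mathbb C$ and $dV$ is Lebesgue measure (with $0^{1/(1-p)}=\infty$ and $0\cdot\infty=0$), and write $\mu\in A_p$ if $A_p(\mu)<\infty$. Let $L^p(D,\mu)$ be the space of measurable $f:D\to\mathbb C$ with $\|f\|_{L^p(D,\mu)}=\left(\int_D|f|^p\mu\,dV\right)^{1/p}<\infty$. Then the operator $$R_\alpha f(z)=\int_D\frac{f(\zeta)}{|\zeta-z|^{\alpha}}\,dV_\zeta$$ is bounded from $L^p(D,\mu)$ into itself for every $\mu\in A_p$, with a bound depending on $\mu$ only through its $A_p$ constant. That is, for every $K\ge 0$ there is a constant $C<\infty$, depending only on $D$, $\alpha$, $p$ and $K$, such that for every $\mu\in A_p$ with $A_p(\mu)\le K$ and every $f\in L^p(D,\mu)$, the integral defining $R_\alpha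 f(z)$ converges absolutely for $\mu\,dV$-almost every $z\in D$, $R_\alpha f\in L^p(D,\mu)$, and $$\|R_\alpha f\|_{L^p(D,\mu)}\le C\,\|f\|_{L^p(D,\mu)}.$$ -/

import Mathlib

open MeasureTheory
open scoped NNReal ENNReal

/-- The Muckenhoupt `A_p` constant of `μ : ℂ → [0, ∞)`, a supremum over all discs `B`, with values
in `[0, ∞]`. Since `1 / (1 - p) < 0` for `p > 1`, the power `μ ^ (1 / (1 - p))` is `∞` where `μ`
vanishes. -/
noncomputable def apConst (p : ℝ) (μ : ℂ → ℝ≥0) : ℝ≥0∞ :=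
  ⨆ (c : ℂ) (r : ℝ) (_ : 0 < r),
    ((volume (Metric.ball c r))⁻¹ * ∫⁻ z in Metric.ball c r, (μ z : ℝ≥0∞)) *
      ((volume (Metric.ball c r))⁻¹ *
        ∫⁻ z in Metric.ball c r, (μ z : ℝ≥0∞) ^ (1 / (1 - p))) ^ (p - 1)

/-- The Muckenhoupt class `A_p` on `ℂ`: Lebesgue measurable weights with finite `A_p` constant. -/
def IsApWeight (p : ℝ) (μ : ℂ → ℝ≥0) : Prop :=
  AEMeasurable μ ∧ apConst p μ < ∞

/-- The measure `μ dV` on `D`; the space `L^p(D, μ)` is the `L^p` space of this measure. -/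
noncomputable def weightedMeasure (D : Set ℂ) (μ : ℂ → ℝ≥0) : Measure ℂ :=
  (volume.restrict D).withDensity fun z => (μ z : ℝ≥0∞)

/-- The integrand `ζ ↦ f(ζ) / |ζ - z|^α`. -/
noncomputable def rieszIntegrand (α : ℝ) (f : ℂ → ℂ) (z ζ : ℂ) : ℂ :=
  f ζ / ((‖ζ - z‖ ^ α : ℝ) : ℂ)

/-- The Riesz-type integral `R_α f(z) = ∫_D f(ζ) / |ζ - z|^α dV_ζ`. -/
noncomputable def rieszIntegral (D : Set ℂ) (α : ℝ) (f : ℂ → ℂ) (z : ℂ) : ℂ :=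
  ∫ ζ in D, rieszIntegrand α f z ζ

/-! The dyadic annuli around `z` bound the kernel `|ζ - z| ^ (-α)` on a set of diameter at most `d`
by a series of multiples of indicators of discs, so `R_α |f|` is bounded by the corresponding
series of integrals of `|f|` over discs centred at `z`. By Minkowski's inequality it suffices to
bound, on `L^p(μ)`, the integral over discs of one fixed radius `r`: Hölder's inequality, Fubini's
theorem and the `A_p` condition on discs of radius `2 * r` give a norm of at most
`A_p(μ) ^ (1 / p)` times the area of such a disc. Since the area is of order `r ^ 2`, the series of
norms is geometric, and it converges because `α < 2`. -/

open Metric Filter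
open scoped Topology

section Lp

variable {X : Type*} [MeasurableSpace X] {ν : Measure X} {p : ℝ}

theorem eLpNorm'_tsum_le (hp : 1 ≤ p) {F : ℕ → X → ℝ≥0∞} (hF : ∀ k, AEMeasurable (F k) ν) :
    eLpNorm' (fun x => ∑' k, F k x) p ν ≤ ∑' k, eLpNorm' (F k) p ν := by
  have hp0 : 0 < p := by linarith
  have partial_le (n : ℕ) :
      ∫⁻ x, (∑ k ∈ Finset.range n, F k x) ^ p ∂ν ≤ (∑' k, eLpNorm' (F k) p ν) ^ p := by
    have h := (eLpNorm'_sum_le (s := Finset.range n)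
      (fun k _ => (hF k).aestronglyMeasurable) hp).trans (ENNReal.sum_le_tsum _)
    rw [eLpNorm'_eq_lintegral_enorm, one_div, ENNReal.rpow_inv_le_iff hp0] at h
    simpa only [Finset.sum_apply, enorm_eq_self] using h
  have tendsto_partial :
      Tendsto (fun n => ∫⁻ x, (∑ k ∈ Finset.range n, F k x) ^ p ∂ν) atTop
        (𝓝 (∫⁻ x, (∑' k, F k x) ^ p ∂ν)) :=
    lintegral_tendsto_of_tendsto_of_monotone
      (fun n => (Finset.aemeasurable_fun_sum _ fun k _ => hF k).pow_const p)
      (.of_forall fun x _ _ hmn => ENNReal.rpow_le_rpow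
        (Finset.sum_le_sum_of_subset (Finset.range_mono hmn)) hp0.le)
      (.of_forall fun x => (ENNReal.tendsto_nat_tsum fun k => F k x).ennrpow_const p)
  rw [eLpNorm'_eq_lintegral_enorm, one_div, ENNReal.rpow_inv_le_iff hp0]
  exact le_of_tendsto' tendsto_partial partial_le

theorem ae_lt_top_of_eLpNorm'_lt_top (hp : 0 < p) {g : X → ℝ≥0∞} (hg : AEMeasurable g ν)
    (h : eLpNorm' g p ν < ∞) : ∀ᵐ x ∂ν, g x < ∞ := by
  have hfin : ∫⁻ x, g x ^ p ∂ν < ∞ := lintegral_rpow_enorm_lt_top_of_eLpNorm'_lt_top hp h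
  filter_upwards [ae_lt_top' (hg.pow_const p) hfin.ne] with x hx
  exact (ENNReal.rpow_lt_top_iff_of_pos hp).1 hx

theorem eLpNorm_ofReal_eq_eLpNorm' {E : Type*} [ENorm E] (hp : 0 < p) (f : X → E) :
    eLpNorm f (ENNReal.ofReal p) ν = eLpNorm' f p ν := by
  rw [eLpNorm_eq_eLpNorm' (by simpa using hp) ENNReal.ofReal_ne_top, ENNReal.toReal_ofReal hp.le]

theorem eLpNorm'_withDensity_eq {w : X → ℝ≥0} (hw : AEMeasurable w ν) {g : X → ℝ≥0∞}
    (hg : AEMeasurable g ν) :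
    eLpNorm' g p (ν.withDensity fun x => (w x : ℝ≥0∞)) =
      (∫⁻ x, g x ^ p * w x ∂ν) ^ (1 / p) := by
  rw [eLpNorm'_eq_lintegral_enorm,
    lintegral_withDensity_eq_lintegral_mul₀ hw.coe_nnreal_ennreal (hg.enorm.pow_const p)]
  simp only [Pi.mul_apply, enorm_eq_self, mul_comm]

theorem lintegral_rpow_le_mul_rpow_dual (hp : 1 < p) {w : X → ℝ≥0} (hw : AEMeasurable w ν)
    (hw0 : ∀ᵐ x ∂ν, w x ≠ 0) {g : X → ℝ≥0∞} (hg : AEMeasurable g ν) :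
    (∫⁻ x, g x ∂ν) ^ p ≤
      (∫⁻ x, g x ^ p * w x ∂ν) * (∫⁻ x, (w x : ℝ≥0∞) ^ (1 / (1 - p)) ∂ν) ^ (p - 1) := by
  have hp0 : 0 < p := by linarith
  have hp1 : p - 1 ≠ 0 := by linarith
  have hp1' : 1 - p ≠ 0 := by linarith
  have hpq : p.HolderConjugate p.conjExponent := .conjExponent hp
  have hw' : AEMeasurable (fun x => (w x : ℝ≥0∞)) ν := hw.coe_nnreal_ennreal
  have split : ∫⁻ x, g x ∂ν =
      ∫⁻ x, g x * (w x : ℝ≥0∞) ^ (1 / p) * (w x : ℝ≥0∞) ^ (-(1 / p)) ∂ν := by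
    refine lintegral_congr_ae (hw0.mono fun x hx => ?_)
    dsimp only
    rw [mul_assoc, ← ENNReal.rpow_add _ _ (by simpa using hx) ENNReal.coe_ne_top, add_neg_cancel,
      ENNReal.rpow_zero, mul_one]
  have rpow_left (x : X) : (g x * (w x : ℝ≥0∞) ^ (1 / p)) ^ p = g x ^ p * w x := by
    rw [ENNReal.mul_rpow_of_nonneg _ _ hp0.le, ← ENNReal.rpow_mul, one_div_mul_cancel hp0.ne',
      ENNReal.rpow_one]
  have rpow_right (x : X) :
      ((w x : ℝ≥0∞) ^ (-(1 / p))) ^ p.conjExponent = (w x : ℝ≥0∞) ^ (1 / (1 - p)) := by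
    rw [← ENNReal.rpow_mul, Real.conjExponent]
    congr 1
    field_simp
    ring
  have holder := ENNReal.lintegral_mul_le_Lp_mul_Lq ν hpq (hg.mul (hw'.pow_const (1 / p)))
    (hw'.pow_const (-(1 / p)))
  simp only [Pi.mul_apply, rpow_left, rpow_right, ← split] at holder
  calc (∫⁻ x, g x ∂ν) ^ p
      ≤ ((∫⁻ x, g x ^ p * w x ∂ν) ^ (1 / p) *
          (∫⁻ x, (w x : ℝ≥0∞) ^ (1 / (1 - p)) ∂ν) ^ (1 / p.conjExponent)) ^ p := by gcongr
    _ = _ := by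
      rw [ENNReal.mul_rpow_of_nonneg _ _ hp0.le, ← ENNReal.rpow_mul, ← ENNReal.rpow_mul,
        one_div_mul_cancel hp0.ne', ENNReal.rpow_one, Real.conjExponent]
      congr 2
      field_simp

end Lp

section BallIntegral

variable {X : Type*} [PseudoMetricSpace X] [MeasurableSpace X] [OpensMeasurableSpace X]
  {ν : Measure X}

theorem setLIntegral_ball_le_of_ap_bound {p : ℝ} (hp : 1 < p) {w : X → ℝ≥0}
    (hw : AEMeasurable w ν) {r : ℝ} {M : ℝ≥0∞} {x : X}
    (hM : (∫⁻ z in ball x (2 * r), w z ∂ν) *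
      (∫⁻ z in ball x (2 * r), (w z : ℝ≥0∞) ^ (1 / (1 - p)) ∂ν) ^ (p - 1) ≤ M) :
    ∫⁻ z in ball x r,
      w z * (∫⁻ ζ in ball z r, (w ζ : ℝ≥0∞) ^ (1 / (1 - p)) ∂ν) ^ (p - 1) ∂ν ≤ M := by
  have : 0 ≤ p - 1 := by linarith
  have ball_subset {z : X} (hz : z ∈ ball x r) : ball z r ⊆ ball x (2 * r) :=
    ball_subset_ball' (by linarith [mem_ball.1 hz])
  have ball_subset_double : ball x r ⊆ ball x (2 * r) := fun z hz => by
    rw [mem_ball] at hz ⊢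
    linarith [dist_nonneg (x := z) (y := x)]
  calc ∫⁻ z in ball x r,
        w z * (∫⁻ ζ in ball z r, (w ζ : ℝ≥0∞) ^ (1 / (1 - p)) ∂ν) ^ (p - 1) ∂ν
      ≤ ∫⁻ z in ball x r,
          w z * (∫⁻ ζ in ball x (2 * r), (w ζ : ℝ≥0∞) ^ (1 / (1 - p)) ∂ν) ^ (p - 1) ∂ν :=
        setLIntegral_mono' measurableSet_ball fun z hz => by
          gcongr
          exact ball_subset hz
    _ = (∫⁻ z in ball x r, w z ∂ν) *
          (∫⁻ ζ in ball x (2 * r), (w ζ : ℝ≥0∞) ^ (1 / (1 - p)) ∂ν) ^ (p - 1) :=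
        lintegral_mul_const'' _ hw.coe_nnreal_ennreal.restrict
    _ ≤ M := le_trans (by gcongr) hM

variable [SecondCountableTopology X]

theorem aemeasurable_indicator_ball_prod {ρ : Measure (X × X)} {H : X × X → ℝ≥0∞}
    (hH : AEMeasurable H ρ) (r : ℝ) :
    AEMeasurable (fun x : X × X => (ball x.1 r).indicator (fun ζ => H (x.1, ζ)) x.2) ρ :=
  hH.indicator (s := {x : X × X | dist x.2 x.1 < r})
    (measurableSet_lt (by fun_prop) measurable_const)

variable [SFinite ν]

theorem aemeasurable_setLIntegral_ball {g : X → ℝ≥0∞} (hg : AEMeasurable g ν) (r : ℝ) :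
    AEMeasurable (fun z => ∫⁻ ζ in ball z r, g ζ ∂ν) ν := by
  simp only [← lintegral_indicator measurableSet_ball]
  exact (aemeasurable_indicator_ball_prod hg.comp_snd r).lintegral_prod_right'

theorem lintegral_mul_setLIntegral_ball {φ g : X → ℝ≥0∞} (hφ : AEMeasurable φ ν)
    (hg : AEMeasurable g ν) (r : ℝ) :
    ∫⁻ z, φ z * ∫⁻ ζ in ball z r, g ζ ∂ν ∂ν = ∫⁻ ζ, (∫⁻ z in ball ζ r, φ z ∂ν) * g ζ ∂ν := by
  calc ∫⁻ z, φ z * ∫⁻ ζ in ball z r, g ζ ∂ν ∂ν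
      = ∫⁻ z, ∫⁻ ζ, (ball z r).indicator (fun ζ => φ z * g ζ) ζ ∂ν ∂ν := by
        refine lintegral_congr fun z => ?_
        rw [lintegral_indicator measurableSet_ball, lintegral_const_mul'' _ hg.restrict]
    _ = ∫⁻ ζ, ∫⁻ z, (ball z r).indicator (fun ζ => φ z * g ζ) ζ ∂ν ∂ν :=
        lintegral_lintegral_swap
          (aemeasurable_indicator_ball_prod (hφ.comp_fst.mul hg.comp_snd) r)
    _ = ∫⁻ ζ, (∫⁻ z in ball ζ r, φ z ∂ν) * g ζ ∂ν := by
        refine lintegral_congr fun ζ => ?_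
        rw [← lintegral_mul_const'' _ hφ.restrict, ← lintegral_indicator measurableSet_ball]
        refine lintegral_congr fun z => ?_
        simp only [Set.indicator, mem_ball, dist_comm ζ z]

theorem eLpNorm'_setLIntegral_ball_le {p : ℝ} (hp : 1 < p) {w : X → ℝ≥0}
    (hw : AEMeasurable w ν) (hw0 : ∀ᵐ x ∂ν, w x ≠ 0) {r : ℝ} {M : ℝ≥0∞}
    (hM : ∀ x, (∫⁻ z in ball x (2 * r), w z ∂ν) *
      (∫⁻ z in ball x (2 * r), (w z : ℝ≥0∞) ^ (1 / (1 - p)) ∂ν) ^ (p - 1) ≤ M)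
    {g : X → ℝ≥0∞} (hg : AEMeasurable g ν) :
    eLpNorm' (fun z => ∫⁻ ζ in ball z r, g ζ ∂ν) p (ν.withDensity fun x => (w x : ℝ≥0∞)) ≤
      M ^ (1 / p) * eLpNorm' g p (ν.withDensity fun x => (w x : ℝ≥0∞)) := by
  have : 0 < p := by linarith
  have hw' : AEMeasurable (fun x => (w x : ℝ≥0∞)) ν := hw.coe_nnreal_ennreal
  have hG : AEMeasurable (fun ζ => g ζ ^ p * w ζ) ν := (hg.pow_const p).mul hw'
  rw [eLpNorm'_withDensity_eq hw (aemeasurable_setLIntegral_ball hg r),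
    eLpNorm'_withDensity_eq hw hg, ← ENNReal.mul_rpow_of_nonneg _ _ (by positivity)]
  gcongr
  set φ : X → ℝ≥0∞ := fun z =>
    w z * (∫⁻ ζ in ball z r, (w ζ : ℝ≥0∞) ^ (1 / (1 - p)) ∂ν) ^ (p - 1) with φ_def
  have hφ : AEMeasurable φ ν :=
    hw'.mul ((aemeasurable_setLIntegral_ball (hw'.pow_const _) r).pow_const _)
  calc ∫⁻ z, (∫⁻ ζ in ball z r, g ζ ∂ν) ^ p * w z ∂ν
      ≤ ∫⁻ z, φ z * ∫⁻ ζ in ball z r, g ζ ^ p * w ζ ∂ν ∂ν := by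
        refine lintegral_mono fun z => ?_
        have holder := lintegral_rpow_le_mul_rpow_dual hp hw.restrict
          (ae_restrict_of_ae (s := ball z r) hw0) hg.restrict
        exact (mul_le_mul_left holder _).trans_eq (by rw [φ_def]; ring)
    _ = ∫⁻ ζ, (∫⁻ z in ball ζ r, φ z ∂ν) * (g ζ ^ p * w ζ) ∂ν :=
        lintegral_mul_setLIntegral_ball hφ hG r
    _ ≤ ∫⁻ ζ, M * (g ζ ^ p * w ζ) ∂ν := by
        gcongr with ζ
        exact setLIntegral_ball_le_of_ap_bound hp hw (hM ζ)
    _ = M * ∫⁻ ζ, g ζ ^ p * w ζ ∂ν := lintegral_const_mul'' _ hG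

end BallIntegral

section ApWeight

variable {p : ℝ} {μ : ℂ → ℝ≥0} {D : Set ℂ}

theorem setLIntegral_ball_mul_rpow_le_apConst (hp : 1 < p) (μ : ℂ → ℝ≥0) (c : ℂ) {r : ℝ}
    (hr : 0 < r) :
    (∫⁻ z in ball c r, (μ z : ℝ≥0∞)) *
        (∫⁻ z in ball c r, (μ z : ℝ≥0∞) ^ (1 / (1 - p))) ^ (p - 1) ≤
      apConst p μ * volume (ball c r) ^ p := by
  set V := volume (ball c r)
  set I := ∫⁻ z in ball c r, (μ z : ℝ≥0∞)
  set S := ∫⁻ z in ball c r, (μ z : ℝ≥0∞) ^ (1 / (1 - p))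
  have hV0 : V ≠ 0 := (measure_ball_pos volume c hr).ne'
  have hVt : V ≠ ∞ := measure_ball_lt_top.ne
  have hp1 : 0 ≤ p - 1 := by linarith
  have average_le : V⁻¹ * I * (V⁻¹ * S) ^ (p - 1) ≤ apConst p μ :=
    le_iSup_of_le c (le_iSup_of_le r (le_iSup_of_le hr le_rfl))
  have rpow_eq : V * V ^ (p - 1) = V ^ p := by
    nth_rewrite 1 [← ENNReal.rpow_one V]
    rw [← ENNReal.rpow_add _ _ hV0 hVt, add_sub_cancel]
  calc I * S ^ (p - 1) = V⁻¹ * V * I * (V⁻¹ * V * S) ^ (p - 1) := by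
        rw [ENNReal.inv_mul_cancel hV0 hVt, one_mul, one_mul]
    _ = V⁻¹ * I * (V⁻¹ * S) ^ (p - 1) * V ^ p := by
        rw [mul_right_comm V⁻¹ V S, ENNReal.mul_rpow_of_nonneg _ V hp1, ← rpow_eq]
        ring
    _ ≤ apConst p μ * V ^ p := by gcongr

theorem IsApWeight.ae_ball_eq_zero_or_ae_ball_ne_zero (hp : 1 < p) (hμ : IsApWeight p μ) (c : ℂ)
    {r : ℝ} (hr : 0 < r) :
    (∀ᵐ z ∂volume.restrict (ball c r), μ z = 0) ∨
      ∀ᵐ z ∂volume.restrict (ball c r), μ z ≠ 0 := by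
  have hm : AEMeasurable (fun z => (μ z : ℝ≥0∞)) := hμ.1.coe_nnreal_ennreal
  refine or_iff_not_imp_left.2 fun hne => ?_
  have hI : ∫⁻ z in ball c r, (μ z : ℝ≥0∞) ≠ 0 := fun h0 =>
    hne (((lintegral_eq_zero_iff' hm.restrict).1 h0).mono fun z hz => by simpa using hz)
  have hprod : (∫⁻ z in ball c r, (μ z : ℝ≥0∞)) *
      (∫⁻ z in ball c r, (μ z : ℝ≥0∞) ^ (1 / (1 - p))) ^ (p - 1) < ∞ :=
    (setLIntegral_ball_mul_rpow_le_apConst hp μ c hr).trans_lt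
      (ENNReal.mul_lt_top hμ.2
        (ENNReal.rpow_lt_top_of_nonneg (by linarith) measure_ball_lt_top.ne))
  have hS : ∫⁻ z in ball c r, (μ z : ℝ≥0∞) ^ (1 / (1 - p)) ≠ ∞ := fun htop => by
    rw [htop, ENNReal.top_rpow_of_pos (by linarith), ENNReal.mul_top hI] at hprod
    exact hprod.ne rfl
  filter_upwards [ae_lt_top' (hm.pow_const _).restrict hS] with z hz h0
  rw [h0, ENNReal.coe_zero, ENNReal.zero_rpow_of_neg (one_div_neg.2 (by linarith))] at hz
  exact hz.ne rfl

theorem IsApWeight.weightedMeasure_eq_zero_or_ae_ne_zero (hp : 1 < p) (hμ : IsApWeight p μ)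
    (hD : Bornology.IsBounded D) :
    weightedMeasure D μ = 0 ∨ ∀ᵐ z ∂volume.restrict D, μ z ≠ 0 := by
  obtain ⟨R, hR, hDR⟩ := hD.subset_ball_lt 0 0
  refine (hμ.ae_ball_eq_zero_or_ae_ball_ne_zero hp 0 hR).imp (fun h => ?_)
    (ae_restrict_of_ae_restrict_of_subset hDR)
  rw [weightedMeasure, withDensity_eq_zero_iff hμ.1.coe_nnreal_ennreal.restrict]
  filter_upwards [ae_restrict_of_ae_restrict_of_subset hDR h] with z hz
  simp [hz]

theorem eLpNorm'_setLIntegral_ball_weightedMeasure_le (hp : 1 < p) (hμ : AEMeasurable μ)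
    (h0 : ∀ᵐ z ∂volume.restrict D, μ z ≠ 0) {r : ℝ} (hr : 0 < r) {g : ℂ → ℝ≥0∞}
    (hg : AEMeasurable g (volume.restrict D)) :
    eLpNorm' (fun z => ∫⁻ ζ in ball z r, g ζ ∂volume.restrict D) p (weightedMeasure D μ) ≤
      volume (ball (0 : ℂ) (2 * r)) * apConst p μ ^ (1 / p) *
        eLpNorm' g p (weightedMeasure D μ) := by
  have hp0 : 0 < p := by linarith
  have hM (z : ℂ) : (∫⁻ ζ in ball z (2 * r), μ ζ ∂volume.restrict D) *
      (∫⁻ ζ in ball z (2 * r), (μ ζ : ℝ≥0∞) ^ (1 / (1 - p)) ∂volume.restrict D) ^ (p - 1) ≤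
        apConst p μ * volume (ball (0 : ℂ) (2 * r)) ^ p := by
    rw [← Measure.addHaar_ball_center volume z]
    refine le_trans ?_ (setLIntegral_ball_mul_rpow_le_apConst hp μ z (mul_pos two_pos hr))
    gcongr <;> exact Measure.restrict_le_self
  refine (eLpNorm'_setLIntegral_ball_le hp hμ.restrict h0 hM hg).trans_eq ?_
  rw [ENNReal.mul_rpow_of_nonneg _ _ (by positivity), ← ENNReal.rpow_mul,
    mul_one_div_cancel hp0.ne', ENNReal.rpow_one, mul_comm (apConst p μ ^ (1 / p)), weightedMeasure]

end ApWeight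

section Dyadic

/-- The outer radius of the `k`-th dyadic annulus `d / 2 ^ (k + 1) < |ζ - z| ≤ d / 2 ^ k`. -/
noncomputable def dyadicRadius (d : ℝ) (k : ℕ) : ℝ := d / 2 ^ k

/-- An upper bound for the kernel `|ζ - z| ^ (-α)` on the `k`-th dyadic annulus; the factor
`2 ^ |α|` makes it valid for either sign of `α`. -/
noncomputable def dyadicWeight (α d : ℝ) (k : ℕ) : ℝ≥0∞ :=
  ENNReal.ofReal (2 ^ |α| * dyadicRadius d k ^ (-α))

/-- The constant in the weighted bound for `R_α` on sets of diameter at most `d`: the `k`-th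
annulus lies in a disc of radius `2 * dyadicRadius d k`, and the norm of the integral over such
discs is controlled by the area of discs of twice that radius. -/
noncomputable def rieszConst (α d : ℝ) : ℝ≥0∞ :=
  ∑' k, dyadicWeight α d k * volume (ball (0 : ℂ) (2 * (2 * dyadicRadius d k)))

variable {α d : ℝ}

theorem dyadicRadius_pos (hd : 0 < d) (k : ℕ) : 0 < dyadicRadius d k := by
  unfold dyadicRadius
  positivity

theorem exists_dyadicRadius_near {t : ℝ} (ht : 0 < t) (htd : t ≤ d) :
    ∃ k, dyadicRadius d k / 2 ≤ t ∧ t ≤ dyadicRadius d k := by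
  obtain ⟨k, hk, hk'⟩ := exists_nat_pow_near ((one_le_div ht).2 htd) one_lt_two
  refine ⟨k, ?_, (le_div_comm₀ (by positivity) ht).1 hk⟩
  rw [dyadicRadius, div_div, ← pow_succ]
  exact ((div_lt_comm₀ ht (by positivity)).1 hk').le

theorem rpow_le_two_rpow_abs_mul_rpow {s t : ℝ} (hs : 0 < s) (hst : s / 2 ≤ t) (hts : t ≤ s)
    (β : ℝ) : t ^ β ≤ 2 ^ |β| * s ^ β := by
  rcases le_total 0 β with hβ | hβ
  · calc t ^ β ≤ s ^ β := Real.rpow_le_rpow (by linarith) hts hβ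
      _ ≤ 2 ^ |β| * s ^ β :=
        le_mul_of_one_le_left (by positivity) (Real.one_le_rpow one_le_two (abs_nonneg β))
  · calc t ^ β ≤ (s / 2) ^ β := Real.rpow_le_rpow_of_nonpos (by positivity) hst hβ
      _ = 2 ^ |β| * s ^ β := by
        rw [Real.div_rpow hs.le zero_le_two, abs_of_nonpos hβ, Real.rpow_neg zero_le_two]
        ring

theorem rieszConst_lt_top (hα : α < 2) (hd : 0 < d) : rieszConst α d < ∞ := by
  have term_eq (k : ℕ) :
      dyadicWeight α d k * volume (ball (0 : ℂ) (2 * (2 * dyadicRadius d k))) =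
        ENNReal.ofReal (2 ^ |α| * d ^ (2 - α)) * 16 * NNReal.pi *
          ENNReal.ofReal (2 ^ (α - 2)) ^ k := by
    have hρ := dyadicRadius_pos hd k
    have rpow_eq : dyadicRadius d k ^ (-α) * dyadicRadius d k ^ 2 =
        d ^ (2 - α) * (2 ^ (α - 2)) ^ k := by
      rw [← Real.rpow_natCast (2 ^ (α - 2)), ← Real.rpow_mul zero_le_two, mul_comm (α - 2),
        Real.rpow_mul zero_le_two, Real.rpow_natCast, ← neg_sub 2 α,
        Real.rpow_neg (by positivity : (0 : ℝ) ≤ 2 ^ k), ← div_eq_mul_inv,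
        ← Real.div_rpow hd.le (by positivity), ← dyadicRadius, ← Real.rpow_natCast _ 2,
        ← Real.rpow_add hρ]
      congr 1
      push_cast
      ring
    have h16 : (16 : ℝ≥0∞) = ENNReal.ofReal 16 := by norm_num
    rw [dyadicWeight, Complex.volume_ball, ← mul_assoc, mul_right_comm _ _ (ENNReal.ofReal _ ^ k),
      h16, ← ENNReal.ofReal_pow (by positivity), ← ENNReal.ofReal_pow (by positivity),
      ← ENNReal.ofReal_mul (by positivity), ← ENNReal.ofReal_mul (by positivity),
      ← ENNReal.ofReal_mul (by positivity)]
    congr 2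
    linear_combination 16 * 2 ^ |α| * rpow_eq
  have ratio_lt_one : ENNReal.ofReal (2 ^ (α - 2)) < 1 :=
    ENNReal.ofReal_lt_one.2 (Real.rpow_lt_one_of_one_lt_of_neg one_lt_two (by linarith))
  rw [rieszConst, tsum_congr term_eq, ENNReal.tsum_mul_left, ENNReal.tsum_geometric]
  refine ENNReal.mul_lt_top (by finiteness) ?_
  exact ENNReal.inv_lt_top.2 (tsub_pos_of_lt ratio_lt_one)

end Dyadic

section Riesz

variable {p α d : ℝ} {μ : ℂ → ℝ≥0} {D : Set ℂ} {f : ℂ → ℂ}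

theorem enorm_rieszIntegrand_le (hd : 0 < d) (f : ℂ → ℂ) {z ζ : ℂ} (hne : ζ ≠ z)
    (hζ : ‖ζ - z‖ ≤ d) :
    ‖rieszIntegrand α f z ζ‖ₑ ≤ ∑' k, dyadicWeight α d k *
      (ball z (2 * dyadicRadius d k)).indicator (fun ζ => ‖f ζ‖ₑ) ζ := by
  have hpos : 0 < ‖ζ - z‖ := norm_pos_iff.2 (sub_ne_zero.2 hne)
  obtain ⟨k, hk, hk'⟩ := exists_dyadicRadius_near hpos hζ
  have hmem : ζ ∈ ball z (2 * dyadicRadius d k) := by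
    rw [mem_ball_iff_norm]
    linarith [dyadicRadius_pos hd k]
  have kernel_le : ‖ζ - z‖ ^ (-α) ≤ 2 ^ |α| * dyadicRadius d k ^ (-α) := by
    simpa only [abs_neg] using rpow_le_two_rpow_abs_mul_rpow (dyadicRadius_pos hd k) hk hk' (-α)
  calc ‖rieszIntegrand α f z ζ‖ₑ = ENNReal.ofReal (‖ζ - z‖ ^ (-α)) * ‖f ζ‖ₑ := by
        rw [← ofReal_norm, ← ofReal_norm, ← ENNReal.ofReal_mul (by positivity), rieszIntegrand,
          norm_div, Complex.norm_real, Real.norm_of_nonneg (by positivity),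
          Real.rpow_neg hpos.le, mul_comm, div_eq_mul_inv]
    _ ≤ dyadicWeight α d k *
          (ball z (2 * dyadicRadius d k)).indicator (fun ζ => ‖f ζ‖ₑ) ζ := by
        rw [Set.indicator_of_mem hmem]
        gcongr
        exact ENNReal.ofReal_le_ofReal kernel_le
    _ ≤ _ := ENNReal.le_tsum k

theorem lintegral_enorm_rieszIntegrand_le (hd : 0 < d) {ν : Measure ℂ} [NullSingletonClass ν]
    (hf : AEMeasurable f ν) {z : ℂ} (hν : ∀ᵐ ζ ∂ν, ‖ζ - z‖ ≤ d) :
    ∫⁻ ζ, ‖rieszIntegrand α f z ζ‖ₑ ∂ν ≤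
      ∑' k, dyadicWeight α d k * ∫⁻ ζ in ball z (2 * dyadicRadius d k), ‖f ζ‖ₑ ∂ν := by
  have hind (k : ℕ) : AEMeasurable
      ((ball z (2 * dyadicRadius d k)).indicator fun ζ => ‖f ζ‖ₑ) ν :=
    hf.enorm.indicator measurableSet_ball
  calc ∫⁻ ζ, ‖rieszIntegrand α f z ζ‖ₑ ∂ν
      ≤ ∫⁻ ζ, ∑' k, dyadicWeight α d k *
          (ball z (2 * dyadicRadius d k)).indicator (fun ζ => ‖f ζ‖ₑ) ζ ∂ν := by
        refine lintegral_mono_ae ?_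
        filter_upwards [hν, compl_mem_ae_iff.2 (measure_singleton z)] with ζ hζ hne
        exact enorm_rieszIntegrand_le hd f hne hζ
    _ = ∑' k, dyadicWeight α d k * ∫⁻ ζ in ball z (2 * dyadicRadius d k), ‖f ζ‖ₑ ∂ν := by
        rw [lintegral_tsum fun k => (hind k).const_mul _]
        exact tsum_congr fun k => by
          rw [lintegral_const_mul'' _ (hind k), lintegral_indicator measurableSet_ball]

theorem weightedMeasure_absolutelyContinuous (D : Set ℂ) (μ : ℂ → ℝ≥0) :
    weightedMeasure D μ ≪ volume.restrict D :=
  withDensity_absolutelyContinuous _ _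

theorem absolutelyContinuous_weightedMeasure (hμ : AEMeasurable μ)
    (h0 : ∀ᵐ z ∂volume.restrict D, μ z ≠ 0) : volume.restrict D ≪ weightedMeasure D μ :=
  withDensity_absolutelyContinuous' hμ.coe_nnreal_ennreal.restrict
    (h0.mono fun _ hz => ENNReal.coe_ne_zero.2 hz)

theorem eLpNorm'_lintegral_enorm_rieszIntegrand_le (hp : 1 < p) {R : ℝ} (hR : 0 < R)
    (hDR : D ⊆ ball 0 R) (hμ : AEMeasurable μ) (h0 : ∀ᵐ z ∂volume.restrict D, μ z ≠ 0)
    (hf : AEMeasurable f (volume.restrict D)) :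
    eLpNorm' (fun z => ∫⁻ ζ in D, ‖rieszIntegrand α f z ζ‖ₑ) p (weightedMeasure D μ) ≤
      rieszConst α (2 * R) * apConst p μ ^ (1 / p) * eLpNorm' f p (weightedMeasure D μ) := by
  have hd : 0 < 2 * R := by positivity
  have hac := weightedMeasure_absolutelyContinuous D μ
  have ae_mem_ball : ∀ᵐ z ∂volume.restrict D, z ∈ ball (0 : ℂ) R :=
    ae_restrict_of_ae_restrict_of_subset hDR (ae_restrict_mem measurableSet_ball)
  have hball (k : ℕ) : AEMeasurable
      (fun z => ∫⁻ ζ in ball z (2 * dyadicRadius (2 * R) k), ‖f ζ‖ₑ ∂volume.restrict D)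
      (weightedMeasure D μ) :=
    (aemeasurable_setLIntegral_ball hf.enorm _).mono_ac hac
  calc eLpNorm' (fun z => ∫⁻ ζ in D, ‖rieszIntegrand α f z ζ‖ₑ) p (weightedMeasure D μ)
      ≤ eLpNorm' (fun z => ∑' k, dyadicWeight α (2 * R) k *
          ∫⁻ ζ in ball z (2 * dyadicRadius (2 * R) k), ‖f ζ‖ₑ ∂volume.restrict D) p
          (weightedMeasure D μ) := by
        refine eLpNorm'_mono_enorm_ae (by linarith) ?_
        filter_upwards [hac.ae_le ae_mem_ball] with z hz
        refine lintegral_enorm_rieszIntegrand_le hd hf (ae_mem_ball.mono fun ζ hζ => ?_)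
        rw [mem_ball_zero_iff] at hz hζ
        linarith [norm_sub_le ζ z]
    _ ≤ ∑' k, dyadicWeight α (2 * R) k * eLpNorm'
          (fun z => ∫⁻ ζ in ball z (2 * dyadicRadius (2 * R) k), ‖f ζ‖ₑ ∂volume.restrict D) p
          (weightedMeasure D μ) := by
        refine (eLpNorm'_tsum_le hp.le fun k => (hball k).const_mul _).trans ?_
        gcongr with k
        exact eLpNorm'_le_mul_eLpNorm'_of_ae_le_mul (hball k).aestronglyMeasurable
          (.of_forall fun z => le_rfl) (by linarith)
    _ ≤ ∑' k, dyadicWeight α (2 * R) k *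
          (volume (ball (0 : ℂ) (2 * (2 * dyadicRadius (2 * R) k))) * apConst p μ ^ (1 / p) *
            eLpNorm' f p (weightedMeasure D μ)) := by
        gcongr with k
        rw [← eLpNorm'_enorm (f := f)]
        exact eLpNorm'_setLIntegral_ball_weightedMeasure_le hp hμ h0
          (mul_pos two_pos (dyadicRadius_pos hd k)) hf.enorm
    _ = _ := by simp only [← mul_assoc, ENNReal.tsum_mul_right, rieszConst]

theorem aestronglyMeasurable_uncurry_rieszIntegrand (α : ℝ) {ν : Measure ℂ} [SFinite ν]
    (hf : AEStronglyMeasurable f ν) :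
    AEStronglyMeasurable (fun x : ℂ × ℂ => rieszIntegrand α f x.1 x.2) (ν.prod ν) :=
  hf.comp_snd.div₀ (by fun_prop : Measurable fun x : ℂ × ℂ =>
    ((‖x.2 - x.1‖ ^ α : ℝ) : ℂ)).aestronglyMeasurable

theorem aestronglyMeasurable_rieszIntegrand (α : ℝ) {ν : Measure ℂ}
    (hf : AEStronglyMeasurable f ν) (z : ℂ) : AEStronglyMeasurable (rieszIntegrand α f z) ν :=
  hf.div₀ (by fun_prop : Measurable fun ζ : ℂ => ((‖ζ - z‖ ^ α : ℝ) : ℂ)).aestronglyMeasurable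

end Riesz

theorem proposition2p2_general {D : Set ℂ} (hD : Bornology.IsBounded D) {α : ℝ} (hα : α < 2)
    {p : ℝ} (hp : 1 < p) (K : ℝ≥0) :
    ∃ C : ℝ≥0, ∀ μ : ℂ → ℝ≥0, IsApWeight p μ → apConst p μ ≤ K →
      ∀ f : ℂ → ℂ, MemLp f (ENNReal.ofReal p) (weightedMeasure D μ) →
        (∀ᵐ z ∂(weightedMeasure D μ), IntegrableOn (rieszIntegrand α f z) D) ∧
        MemLp (rieszIntegral D α f) (ENNReal.ofReal p) (weightedMeasure D μ) ∧
        eLpNorm (rieszIntegral D α f) (ENNReal.ofReal p) (weightedMeasure D μ) ≤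
          C * eLpNorm f (ENNReal.ofReal p) (weightedMeasure D μ) := by
  have hp0 : 0 < p := by linarith
  obtain ⟨R, hR, hDR⟩ := hD.subset_ball_lt 0 0
  have hC : rieszConst α (2 * R) * (K : ℝ≥0∞) ^ (1 / p) ≠ ∞ :=
    ENNReal.mul_ne_top (rieszConst_lt_top hα (by positivity)).ne
      (ENNReal.rpow_ne_top_of_nonneg (by positivity) ENNReal.coe_ne_top)
  refine ⟨(rieszConst α (2 * R) * (K : ℝ≥0∞) ^ (1 / p)).toNNReal, fun μ hμ hK f hf => ?_⟩
  rw [ENNReal.coe_toNNReal hC]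
  rcases hμ.weightedMeasure_eq_zero_or_ae_ne_zero hp hD with hzero | h0
  · simp [hzero]
  have hac := weightedMeasure_absolutelyContinuous D μ
  have hfD : AEStronglyMeasurable f (volume.restrict D) :=
    hf.1.mono_ac (absolutelyContinuous_weightedMeasure hμ.1 h0)
  have hkernel := aestronglyMeasurable_uncurry_rieszIntegrand α hfD
  set T : ℂ → ℝ≥0∞ := fun z => ∫⁻ ζ in D, ‖rieszIntegrand α f z ζ‖ₑ
  have hT : AEMeasurable T (weightedMeasure D μ) :=
    hkernel.enorm.lintegral_prod_right'.mono_ac hac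
  have norm_T_le : eLpNorm' T p (weightedMeasure D μ) ≤ rieszConst α (2 * R) *
      (K : ℝ≥0∞) ^ (1 / p) * eLpNorm f (ENNReal.ofReal p) (weightedMeasure D μ) := by
    rw [eLpNorm_ofReal_eq_eLpNorm' hp0]
    refine (eLpNorm'_lintegral_enorm_rieszIntegrand_le hp hR hDR hμ.1 h0 hfD.aemeasurable).trans ?_
    gcongr
  have norm_T_lt_top := norm_T_le.trans_lt (ENNReal.mul_lt_top hC.lt_top hf.2)
  have norm_riesz_le : eLpNorm (rieszIntegral D α f) (ENNReal.ofReal p) (weightedMeasure D μ) ≤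
      eLpNorm' T p (weightedMeasure D μ) := by
    rw [eLpNorm_ofReal_eq_eLpNorm' hp0]
    exact eLpNorm'_mono_enorm_ae hp0.le
      (.of_forall fun z => enorm_integral_le_lintegral_enorm _)
  refine ⟨?_, ⟨?_, norm_riesz_le.trans_lt norm_T_lt_top⟩, norm_riesz_le.trans norm_T_le⟩
  · filter_upwards [ae_lt_top_of_eLpNorm'_lt_top hp0 hT norm_T_lt_top] with z hz
    exact ⟨aestronglyMeasurable_rieszIntegrand α hfD z, hz⟩
  · exact hkernel.integral_prod_right'.mono_ac hac

theorem proposition2p2 (D : Set ℂ) (hDo : IsOpen D) (hDc : IsConnected D)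
    (hDb : Bornology.IsBounded D) (α : ℝ) (hα0 : 0 < α) (hα2 : α < 2) (p : ℝ) (hp : 1 < p)
    (K : ℝ≥0) :
    ∃ C : ℝ≥0, ∀ μ : ℂ → ℝ≥0, IsApWeight p μ → apConst p μ ≤ K →
      ∀ f : ℂ → ℂ, MemLp f (ENNReal.ofReal p) (weightedMeasure D μ) →
        (∀ᵐ z ∂(weightedMeasure D μ), IntegrableOn (rieszIntegrand α f z) D) ∧
        MemLp (rieszIntegral D α f) (ENNReal.ofReal p) (weightedMeasure D μ) ∧
        eLpNorm (rieszIntegral D α f) (ENNReal.ofReal p) (weightedMeasure D μ) ≤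
          C * eLpNorm f (ENNReal.ofReal p) (weightedMeasure D μ) := by
  exact proposition2p2_general hDb hα2 hp K
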